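/- Let $d$ be a natural number and $\mathbb T^d=\mathbb R^d/\mathbb Z^d$. For $\Omega\subseteq\mathbb R^d$ let $\mathcal F(\Omega)$ be the set of all continuous integrable functions $f:\mathbb R^d\to\mathbb R$ with $\operatorname{supp} f\subseteq\Omega$ (closed support), $f(0)=1$, that are positive definite in the sense that $\widehat f(\xi)=\int_{\mathbb R^d}f(x)e^{-2\pi i\langle x,\xi\rangle}\,dx$ is real and nonnegative for every $\xi\in\mathbb R^d$. For $z\in\mathbb R^d$ put $$\mathcal M(\Omega,z):=\sup_{f\in\mathcal F(\Omega)}f(z).$$ For $\Omega\subseteq\mathbb T^d$ let $\mathcal F^*(\Omega)$ be the set of all continuous functions $f:\mathbb T^d\to\mathbb R$ with $\operatorname{supp} f\subseteq\Omega$, $f(0)=1$, that are positive definite in the sense that $\widehat f(n)=\int_{\mathbb T^d}f(x)e^{-2\pi i\langle n,x\rangle}\,dx$ is real and nonnegative for every $n\in\mathbb Z^d$. For $z\in\mathbb T^d$ put $$\mathcal M^*(\Omega,z):=\sup_{f\in\mathcal F^*(\Omega)}f(z).$$ Suprema are taken in $[-\infty,\infty]$, with $\sup\emptyset=-\infty$.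 Subsets and points of $\mathbb R^d$ are regarded as subsets and points of $\mathbb T^d$ via the quotient map $\mathbb R^d\to\mathbb T^d$; for bounded $\Omega$ and all sufficiently small $\alpha>0$ one has $\alpha\Omega\subset(-\tfrac12,\tfrac12)^d$, where this map is injective. Theorem. For every bounded open set $\Omega\subset\mathbb R^d$ and every $z\in\mathbb R^d$, $$\lim_{\alpha\to0+}\mathcal M^*(\alpha\Omega,\alpha z)=\mathcal M(\Omega,z).$$ -/

import Mathlib

open Filter Topology MeasureTheory
open scoped FourierTransform ComplexOrder Pointwise

noncomputable section

/-- The class `𝓕(Ω)` for `Ω ⊆ ℝᵈ`: continuous integrable functions `f : ℝᵈ → ℝ` whose (closed)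
support lies in `Ω`, with `f 0 = 1`, and which are positive definite, that is, whose Fourier
transform is real and nonnegative everywhere (`0 ≤ w` for a complex number `w` means `w` is real
and nonnegative). -/
def spaceClass {d : ℕ} (Ω : Set (EuclideanSpace ℝ (Fin d))) :
    Set (EuclideanSpace ℝ (Fin d) → ℝ) :=
  {f | Continuous f ∧ Integrable f ∧ tsupport f ⊆ Ω ∧ f 0 = 1 ∧
    ∀ ξ : EuclideanSpace ℝ (Fin d),
      0 ≤ 𝓕 (fun x : EuclideanSpace ℝ (Fin d) => (f x : ℂ)) ξ}

/-- The class `𝓕*(Ω)` for `Ω ⊆ 𝕋ᵈ = ℝᵈ / ℤᵈ`: continuous functions `f : 𝕋ᵈ → ℝ` whose (closed)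
support lies in `Ω`, with `f 0 = 1`, and which are positive definite, that is, all of whose Fourier
coefficients are real and nonnegative. -/
def torusClass {d : ℕ} (Ω : Set (UnitAddTorus (Fin d))) :
    Set (UnitAddTorus (Fin d) → ℝ) :=
  {f | Continuous f ∧ tsupport f ⊆ Ω ∧ f 0 = 1 ∧
    ∀ n : Fin d → ℤ,
      0 ≤ UnitAddTorus.mFourierCoeff (fun x : UnitAddTorus (Fin d) => (f x : ℂ)) n}

/-- The space extremal value `𝓜(Ω, z)`, the supremum of `f z` over `f ∈ 𝓕(Ω)`. It is taken in the
extended reals, so that the supremum over an empty class is `-∞`. -/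
def spaceExtremal {d : ℕ} (Ω : Set (EuclideanSpace ℝ (Fin d)))
    (z : EuclideanSpace ℝ (Fin d)) : EReal :=
  ⨆ f ∈ spaceClass Ω, (f z : EReal)

/-- The torus extremal value `𝓜*(Ω, z)`, the supremum of `f z` over `f ∈ 𝓕*(Ω)`. -/
def torusExtremal {d : ℕ} (Ω : Set (UnitAddTorus (Fin d)))
    (z : UnitAddTorus (Fin d)) : EReal :=
  ⨆ f ∈ torusClass Ω, (f z : EReal)

/-- The quotient map `ℝᵈ → 𝕋ᵈ = ℝᵈ / ℤᵈ`. A subset of `ℝᵈ` is read as a subset of `𝕋ᵈ` by taking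
its image; on subsets of the open cube `(-1/2, 1/2)ᵈ` this map is injective. -/
def toTorus {d : ℕ} (x : EuclideanSpace ℝ (Fin d)) : UnitAddTorus (Fin d) :=
  fun i => (x i : UnitAddCircle)

end

/-! For small α both αΩ and αz lie in the open unit cube, and two inequalities squeeze the torus
value. Lower bound (`le_torusExtremal_smul`): a space function, dilated by α and wrapped onto the
torus, is admissible there, since its Fourier coefficients are values of its Fourier transform at
integer points.

Upper bound (`mul_le_spaceExtremal`): simply unrolling a torus function f would control its
transform only at integer frequencies. Multiplying by a fixed positive definite φ supported in the
cube, with φ(0) = 1, repairs this: by Parseval the transform of fφ at ξ is the sum over n of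
conj(f̂(n)) φ̂(ξ + n), which is nonnegative (`fourier_toTorus_mul_nonneg`). Hence f(αz)φ(αz) is at
most the space value. As φ does not depend on α and φ(αz) → 1, the two bounds meet. -/

noncomputable section TorusLift

open scoped ComplexConjugate

/-- The normalised Haar measure on the circle, the one with respect to which Mathlib defines the
Fourier coefficients on the torus. -/
local instance : MeasureSpace UnitAddCircle := ⟨AddCircle.haarAddCircle⟩

local instance : IsProbabilityMeasure (volume : Measure UnitAddCircle) :=
  inferInstanceAs (IsProbabilityMeasure AddCircle.haarAddCircle)

variable {d : ℕ} {F : Type*}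

/-- The open unit cube centred at the origin. -/
def centredCube (d : ℕ) : Set (EuclideanSpace ℝ (Fin d)) := {x | ∀ i, |x i| < 1 / 2}

/-- The function on the torus whose values are those of `u` on the half-open unit cube
`(-1/2, 1/2]ᵈ`. -/
def torusLift (u : EuclideanSpace ℝ (Fin d) → F) (t : UnitAddTorus (Fin d)) : F :=
  u (WithLp.toLp 2 fun i => (AddCircle.equivIoc 1 (-(1 / 2) : ℝ) (t i) : ℝ))

theorem continuous_toTorus : Continuous (toTorus (d := d)) :=
  continuous_pi fun i => (AddCircle.continuous_mk' 1).comp (by fun_prop)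

theorem toTorus_injOn_centredCube : Set.InjOn (toTorus (d := d)) (centredCube d) := by
  intro x hx y hy h
  ext i
  have hx' := abs_lt.1 (hx i)
  have hy' := abs_lt.1 (hy i)
  refine (AddCircle.coe_eq_coe_iff_of_mem_Ioc (p := (1 : ℝ)) (a := -(1 / 2)) ⟨?_, ?_⟩
    ⟨?_, ?_⟩).1 (congrFun h i) <;> linarith

theorem torusLift_toTorus (u : EuclideanSpace ℝ (Fin d) → F) {x : EuclideanSpace ℝ (Fin d)}
    (hx : ∀ i, x i ∈ Set.Ioc (-(1 / 2) : ℝ) (-(1 / 2) + 1)) : torusLift u (toTorus x) = u x := by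
  unfold torusLift
  congr 1
  ext i
  exact AddCircle.equivIoc_coe_of_mem (p := (1 : ℝ)) (hx i)

theorem mem_Ioc_of_mem_centredCube {x : EuclideanSpace ℝ (Fin d)} (hx : x ∈ centredCube d)
    (i : Fin d) : x i ∈ Set.Ioc (-(1 / 2) : ℝ) (-(1 / 2) + 1) := by
  have := abs_lt.1 (hx i)
  constructor <;> linarith

theorem isCompact_of_subset_centredCube {s : Set (EuclideanSpace ℝ (Fin d))} (hs : IsClosed s)
    (hsub : s ⊆ centredCube d) : IsCompact s := by
  refine Metric.isCompact_of_isClosed_isBounded hs ?_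
  have hK : IsCompact (Set.univ.pi fun _ : Fin d => Set.Icc (-(1 / 2) : ℝ) (1 / 2)) :=
    isCompact_univ_pi fun _ => isCompact_Icc
  have := hK.image (PiLp.continuous_toLp 2 (fun _ : Fin d => ℝ))
  refine this.isBounded.subset fun x hx => ⟨x.ofLp, fun i _ => ?_, rfl⟩
  exact abs_le.1 (hsub hx i).le

theorem support_torusLift_subset [Zero F] (u : EuclideanSpace ℝ (Fin d) → F) :
    Function.support (torusLift u) ⊆ toTorus '' tsupport u := by
  intro t ht
  refine ⟨_, subset_tsupport u ht, ?_⟩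
  ext i
  exact AddCircle.coe_equivIoc

theorem isClosed_toTorus_image_tsupport [Zero F] {u : EuclideanSpace ℝ (Fin d) → F}
    (hu : tsupport u ⊆ centredCube d) : IsClosed (toTorus '' tsupport u) :=
  ((isCompact_of_subset_centredCube (isClosed_tsupport u) hu).image continuous_toTorus).isClosed

theorem tsupport_torusLift_subset [Zero F] {u : EuclideanSpace ℝ (Fin d) → F}
    (hu : tsupport u ⊆ centredCube d) : tsupport (torusLift u) ⊆ toTorus '' tsupport u :=
  closure_minimal (support_torusLift_subset u) (isClosed_toTorus_image_tsupport hu)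

theorem continuous_torusLift [TopologicalSpace F] [Zero F] {u : EuclideanSpace ℝ (Fin d) → F}
    (hc : Continuous u) (hu : tsupport u ⊆ centredCube d) : Continuous (torusLift u) := by
  refine continuous_iff_continuousAt.2 fun t => ?_
  -- The representative in the half-open cube jumps only where some coordinate is -1/2. The closed
  -- support stays away from these walls, so the lift vanishes near them.
  by_cases ht : ∀ i, t i ≠ ((-(1 / 2) : ℝ) : UnitAddCircle)
  · refine hc.continuousAt.comp ?_
    refine (PiLp.continuous_toLp 2 (fun _ : Fin d => ℝ)).continuousAt.comp ?_
    refine continuousAt_pi.2 fun i => ?_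
    exact continuous_subtype_val.continuousAt.comp
      (ContinuousAt.comp (f := fun s : UnitAddTorus (Fin d) => s i)
        (AddCircle.continuousAt_equivIoc 1 (-(1 / 2) : ℝ) (ht i)) (continuousAt_apply i t))
  · push Not at ht
    obtain ⟨i, hi⟩ := ht
    have hmem : t ∉ toTorus '' tsupport u := by
      rintro ⟨x, hx, rfl⟩
      have hx' := abs_lt.1 (hu hx i)
      have := (AddCircle.coe_eq_coe_iff_of_mem_Ico (p := (1 : ℝ)) (a := -(1 / 2)) ⟨by linarith,
        by linarith⟩ ⟨by linarith, by linarith⟩).1 hi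
      linarith
    have hev : torusLift u =ᶠ[𝓝 t] fun _ => 0 := by
      filter_upwards [(isClosed_toTorus_image_tsupport hu).isOpen_compl.mem_nhds hmem] with s hs
      by_contra h
      exact hs (support_torusLift_subset u h)
    exact continuousAt_const.congr hev.symm

/-! ### Fourier coefficients on the torus and Fourier transforms on space -/

/-- An integer vector as a point of Euclidean space. -/
def intVector (n : Fin d → ℤ) : EuclideanSpace ℝ (Fin d) := WithLp.toLp 2 fun i => (n i : ℝ)

theorem mFourier_neg_toTorus (n : Fin d → ℤ) (x : EuclideanSpace ℝ (Fin d)) :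
    UnitAddTorus.mFourier (-n) (toTorus x) = 𝐞 (-inner ℝ x (intVector n)) := by
  simp only [UnitAddTorus.mFourier, ContinuousMap.coe_mk, toTorus, fourier_coe_apply,
    Real.fourierChar_apply, ← Complex.exp_sum, intVector, PiLp.inner_apply]
  congr 1
  simp only [Pi.neg_apply, RCLike.inner_apply, conj_trivial]
  push_cast
  simp only [Finset.mul_sum, Finset.sum_mul, ← Finset.sum_neg_distrib]
  exact Finset.sum_congr rfl fun i _ => by ring

/-- If `G` agrees with `u` on the unit cube and `u` vanishes elsewhere, then the Fourier
coefficients of `G` are values of the Fourier transform of `u`. -/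
theorem mFourierCoeff_eq_fourier {u : EuclideanSpace ℝ (Fin d) → ℂ} {G : UnitAddTorus (Fin d) → ℂ}
    (hG : ∀ x : EuclideanSpace ℝ (Fin d), (∀ i, x i ∈ Set.Ioc (-(1 / 2) : ℝ) (-(1 / 2) + 1)) →
      G (toTorus x) = u x)
    (hu : tsupport u ⊆ centredCube d) (n : Fin d → ℤ) :
    UnitAddTorus.mFourierCoeff G n = 𝓕 u (intVector n) := by
  rw [UnitAddTorus.mFourierCoeff_eq_integral G n fun _ => -(1 / 2), Real.fourier_eq,
    ← (PiLp.volume_preserving_toLp (Fin d)).integral_comp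
      (MeasurableEquiv.toLp 2 (Fin d → ℝ)).measurableEmbedding]
  refine Eq.trans ?_ (setIntegral_eq_integral_of_forall_compl_eq_zero
    (s := {x : Fin d → ℝ | ∀ i, x i ∈ Set.Ioc (-(1 / 2) : ℝ) (-(1 / 2) + 1)}) ?_)
  · refine setIntegral_congr_fun (MeasurableSet.univ_pi' (δ := Fin d) (X := fun _ => ℝ)
      (t := fun _ => Set.Ioc (-(1 / 2)) (-(1 / 2) + 1)) fun i => measurableSet_Ioc) fun x hx => ?_
    have h1 := mFourier_neg_toTorus n (WithLp.toLp 2 x)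
    have h2 := hG (WithLp.toLp 2 x) hx
    change UnitAddTorus.mFourier (-n) (toTorus (WithLp.toLp 2 x)) •
      G (toTorus (WithLp.toLp 2 x)) = _
    rw [h1, h2, Circle.smul_def]
  · intro x hx
    have : WithLp.toLp 2 x ∉ tsupport u := fun h => hx (mem_Ioc_of_mem_centredCube (hu h))
    rw [image_eq_zero_of_notMem_tsupport this, smul_zero]

/-- **Parseval's identity** for continuous functions on the torus. -/
theorem hasSum_conj_mFourierCoeff_mul (f g : C(UnitAddTorus (Fin d), ℂ)) :
    HasSum (fun n => conj (UnitAddTorus.mFourierCoeff f n) * UnitAddTorus.mFourierCoeff g n)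
      (UnitAddTorus.mFourierCoeff (fun t => conj (f t) * g t) 0) := by
  have h := UnitAddTorus.hasSum_prod_mFourierCoeff (ContinuousMap.toLp (E := ℂ) 2 volume ℂ f)
    (ContinuousMap.toLp (E := ℂ) 2 volume ℂ g)
  simp only [UnitAddTorus.mFourierCoeff_toLp] at h
  convert h using 1
  refine integral_congr_ae ?_
  filter_upwards [ContinuousMap.coeFn_toLp (𝕜 := ℂ) (p := 2) volume f,
    ContinuousMap.coeFn_toLp (𝕜 := ℂ) (p := 2) volume g] with t hf hg
  rw [hf, hg, neg_zero, UnitAddTorus.mFourier_zero, ContinuousMap.one_apply, one_smul]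

/-- The product of a positive definite function on the torus with a positive definite function
supported in the unit cube is positive definite on space. -/
theorem fourier_toTorus_mul_nonneg {f : UnitAddTorus (Fin d) → ℝ} (hf : Continuous f)
    (hpos : ∀ n, 0 ≤ UnitAddTorus.mFourierCoeff (fun t => (f t : ℂ)) n)
    {φ : EuclideanSpace ℝ (Fin d) → ℝ} (hφ : Continuous φ) (hsupp : tsupport φ ⊆ centredCube d)
    (hφpos : ∀ ξ, 0 ≤ 𝓕 (fun x => (φ x : ℂ)) ξ) (ξ : EuclideanSpace ℝ (Fin d)) :
    0 ≤ 𝓕 (fun x => ((f (toTorus x) * φ x : ℝ) : ℂ)) ξ := by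
  -- Modulating φ by the character of ξ turns the transform of fφ at ξ into the zeroth Fourier
  -- coefficient of a product, to which Parseval applies.
  set u : EuclideanSpace ℝ (Fin d) → ℂ := fun x => 𝐞 (-inner ℝ x ξ) • (φ x : ℂ) with hu
  have huc : Continuous u := by
    have : Continuous fun x : EuclideanSpace ℝ (Fin d) => 𝐞 (-inner ℝ x ξ) :=
      Real.continuous_fourierChar.comp (by fun_prop)
    exact this.smul (Complex.continuous_ofReal.comp hφ)
  have hsub : ∀ v : EuclideanSpace ℝ (Fin d) → ℂ, (∀ x, φ x = 0 → v x = 0) →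
      tsupport v ⊆ centredCube d := fun v hv =>
    (closure_mono (Function.support_subset_iff'.2 fun x hx => hv x (by simpa using hx))).trans
      hsupp
  have husupp : tsupport u ⊆ centredCube d := hsub u fun x hx => by simp [hu, hx]
  have hfu : tsupport (fun x => (f (toTorus x) : ℂ) * u x) ⊆ centredCube d :=
    hsub _ fun x hx => by simp [hu, hx]
  have h := hasSum_conj_mFourierCoeff_mul ⟨fun t => (f t : ℂ), Complex.continuous_ofReal.comp hf⟩
    ⟨torusLift u, continuous_torusLift huc husupp⟩
  simp only [ContinuousMap.coe_mk, Complex.conj_ofReal] at h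
  rw [mFourierCoeff_eq_fourier (fun x hx => by rw [torusLift_toTorus u hx]) hfu] at h
  have key : 𝓕 (fun x => ((f (toTorus x) * φ x : ℝ) : ℂ)) ξ =
      𝓕 (fun x => (f (toTorus x) : ℂ) * u x) (intVector 0) := by
    rw [Real.fourier_eq, Real.fourier_eq]
    have h0 : intVector (0 : Fin d → ℤ) = 0 := by ext i; simp [intVector]
    simp only [h0, inner_zero_right, neg_zero, AddChar.map_zero_eq_one, one_smul, hu,
      Circle.smul_def, smul_eq_mul]
    congr 1 with x
    push_cast
    ring
  rw [key]
  refine h.nonneg fun n => mul_nonneg ?_ ?_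
  · rw [Complex.conj_eq_iff_im.2 (Complex.le_def.1 (hpos n)).2.symm]
    exact hpos n
  · rw [mFourierCoeff_eq_fourier (fun x hx => torusLift_toTorus u hx) husupp]
    -- The modulation shifts the frequency n to ξ + n.
    convert hφpos (ξ + intVector n) using 1
    rw [Real.fourier_eq, Real.fourier_eq]
    congr 1 with x
    rw [hu, smul_smul, ← AddChar.map_add_eq_mul, inner_add_right]
    congr 2
    ring

/-- The lift to the torus of a positive definite function supported in the unit cube is positive
definite. -/
theorem mFourierCoeff_torusLift_nonneg {u : EuclideanSpace ℝ (Fin d) → ℝ}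
    (hu : tsupport u ⊆ centredCube d) (hpos : ∀ ξ, 0 ≤ 𝓕 (fun x => (u x : ℂ)) ξ)
    (n : Fin d → ℤ) :
    0 ≤ UnitAddTorus.mFourierCoeff (fun t => ((torusLift u t : ℝ) : ℂ)) n := by
  have hsub : tsupport (fun x => (u x : ℂ)) ⊆ centredCube d :=
    (closure_mono (Function.support_subset_iff'.2 fun x hx => by simpa using hx)).trans hu
  rw [mFourierCoeff_eq_fourier (u := fun x => (u x : ℂ))
    (fun x hx => by rw [torusLift_toTorus u hx]) hsub]
  exact hpos _

end TorusLift

/-! ### Dilations and a positive definite cutoff on space -/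

section Space

variable {d : ℕ}

theorem fourier_comp_smul_nonneg {u : EuclideanSpace ℝ (Fin d) → ℝ}
    (hpos : ∀ ξ, 0 ≤ 𝓕 (fun x => (u x : ℂ)) ξ) {r : ℝ} (hr : r ≠ 0)
    (ξ : EuclideanSpace ℝ (Fin d)) :
    0 ≤ 𝓕 (fun x => (u (r • x) : ℂ)) ξ := by
  have h : 𝓕 (fun x => (u (r • x) : ℂ)) ξ =
      |(r ^ Module.finrank ℝ (EuclideanSpace ℝ (Fin d)))⁻¹| •
        𝓕 (fun x => (u x : ℂ)) (r⁻¹ • ξ) := by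
    rw [Real.fourier_eq, Real.fourier_eq, ← Measure.integral_comp_smul]
    congr 1 with x
    rw [real_inner_smul_left, real_inner_smul_right, mul_inv_cancel_left₀ hr]
  rw [h]
  exact smul_nonneg (abs_nonneg _) (hpos _)

/-- The Fourier transform of an even real function is real. -/
theorem conj_fourier_of_even {u : EuclideanSpace ℝ (Fin d) → ℝ} (hu : ∀ x, u (-x) = u x)
    (ξ : EuclideanSpace ℝ (Fin d)) :
    (starRingEnd ℂ) (𝓕 (fun x => (u x : ℂ)) ξ) = 𝓕 (fun x => (u x : ℂ)) ξ := by
  rw [Real.fourier_eq, ← integral_conj, ← integral_neg_eq_self]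
  congr 1 with x
  simp [Circle.smul_def, hu, Real.fourierChar_apply, ← Complex.exp_conj, Complex.conj_ofNat]

/-- There is a continuous positive definite function with value `1` at the origin whose support is
contained in the open unit cube. -/
theorem exists_posDef_tsupport_subset_centredCube (d : ℕ) :
    ∃ φ : EuclideanSpace ℝ (Fin d) → ℝ, Continuous φ ∧ tsupport φ ⊆ centredCube d ∧ φ 0 = 1 ∧
      ∀ ξ, 0 ≤ 𝓕 (fun x => (φ x : ℂ)) ξ := by
  -- The self-convolution of an even real bump has as its transform the square of a real function.
  -- Outer radius 1/8 puts its support within radius 1/4 < 1/2.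
  let b : ContDiffBump (0 : EuclideanSpace ℝ (Fin d)) :=
    ⟨1 / 16, 1 / 8, by norm_num, by norm_num⟩
  have hbc : Continuous b := b.continuous
  have hbi : Integrable b := hbc.integrable_of_hasCompactSupport b.hasCompactSupport
  let ψ : EuclideanSpace ℝ (Fin d) → ℝ :=
    MeasureTheory.convolution b b (ContinuousLinearMap.lsmul ℝ ℝ) volume
  have hψc : Continuous ψ := b.hasCompactSupport.continuous_convolution_right _
    hbi.locallyIntegrable hbc
  have hψs : Function.support ψ ⊆ Metric.closedBall 0 (1 / 4) := by
    refine (support_convolution_subset _).trans ?_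
    rintro _ ⟨x, hx, y, hy, rfl⟩
    rw [b.support_eq, mem_ball_zero_iff] at hx hy
    rw [mem_closedBall_zero_iff]
    refine (norm_add_le x y).trans ?_
    have h8 : b.rOut = 1 / 8 := rfl
    rw [h8] at hx hy
    linarith
  have hψ0 : 0 < ψ 0 := by
    have h : ψ 0 = ∫ t, b t * b t := by
      simp [ψ, convolution_def, b.neg]
    rw [h]
    have hc : Continuous fun t => b t * b t := hbc.mul hbc
    refine hc.integral_pos_of_hasCompactSupport_nonneg_nonzero b.hasCompactSupport.mul_left
      (fun t => mul_self_nonneg _) (x := 0) ?_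
    have h1 : b 0 = 1 := b.one_of_mem_closedBall (Metric.mem_closedBall_self b.rIn_pos.le)
    simp [h1]
  have hψF : ∀ ξ, 0 ≤ 𝓕 (fun x => (ψ x : ℂ)) ξ := by
    intro ξ
    have h : (fun x => (ψ x : ℂ)) = MeasureTheory.convolution (fun x => (b x : ℂ))
        (fun x => (b x : ℂ)) (ContinuousLinearMap.mul ℂ ℂ) volume := by
      ext x
      simp only [ψ, convolution_def, ContinuousLinearMap.lsmul_apply, smul_eq_mul,
        ContinuousLinearMap.mul_apply', ← Complex.ofReal_mul]
      exact integral_ofReal.symm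
    have hmul : 𝓕 (fun x => (ψ x : ℂ)) ξ =
        𝓕 (fun x => (b x : ℂ)) ξ * 𝓕 (fun x => (b x : ℂ)) ξ := by
      rw [h]
      exact Real.fourier_mul_convolution_eq hbi.ofReal hbi.ofReal ξ
    rw [hmul]
    have := conj_fourier_of_even (u := b) (fun x => b.neg x) ξ
    rw [Complex.conj_eq_iff_real] at this
    obtain ⟨r, hr⟩ := this
    rw [hr, ← Complex.ofReal_mul]
    exact_mod_cast mul_self_nonneg r
  refine ⟨fun x => (ψ 0)⁻¹ * ψ x, by fun_prop, ?_, inv_mul_cancel₀ hψ0.ne', fun ξ => ?_⟩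
  · intro x hx i
    have h1 : x ∈ Metric.closedBall (0 : EuclideanSpace ℝ (Fin d)) (1 / 4) :=
      closure_minimal ((Function.support_subset_iff'.2 fun y hy => by
        rw [Function.notMem_support.1 fun h => hy (hψs h), mul_zero])) Metric.isClosed_closedBall hx
    have h2 := PiLp.norm_apply_le x i
    rw [Real.norm_eq_abs] at h2
    rw [mem_closedBall_zero_iff] at h1
    linarith
  · have h : 𝓕 (fun x => (((ψ 0)⁻¹ * ψ x : ℝ) : ℂ)) ξ =
        ((ψ 0)⁻¹ : ℝ) * 𝓕 (fun x => (ψ x : ℂ)) ξ := by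
      rw [Real.fourier_eq, Real.fourier_eq, ← integral_const_mul]
      congr 1 with x
      simp only [Circle.smul_def, smul_eq_mul]
      push_cast
      ring
    rw [h]
    exact mul_nonneg (by exact_mod_cast (inv_pos.2 hψ0).le) (hψF ξ)

end Space

/-! ### Comparison of the two extremal values -/

section Limit

variable {d : ℕ} {Ω : Set (EuclideanSpace ℝ (Fin d))} {z : EuclideanSpace ℝ (Fin d)} {α : ℝ}

theorem le_torusExtremal_smul (hα : 0 < α) (hΩ : α • Ω ⊆ centredCube d)
    (hz : α • z ∈ centredCube d) :
    spaceExtremal Ω z ≤ torusExtremal (toTorus '' (α • Ω)) (toTorus (α • z)) := by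
  refine iSup₂_le fun f ⟨hfc, _, hfs, hf0, hfF⟩ => ?_
  set u : EuclideanSpace ℝ (Fin d) → ℝ := fun x => f (α⁻¹ • x) with hu
  have huc : Continuous u := by fun_prop
  have hus : tsupport u ⊆ α • Ω := by
    refine (closure_minimal (t := (fun x => α⁻¹ • x) ⁻¹' tsupport f)
      (fun x hx => subset_tsupport f hx)
      ((isClosed_tsupport f).preimage (by fun_prop))).trans fun x hx => ?_
    exact (Set.mem_smul_set_iff_inv_smul_mem₀ hα.ne' _ _).2 (hfs hx)
  have hucube := hus.trans hΩ
  have hmem : torusLift u ∈ torusClass (toTorus '' (α • Ω)) := by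
    refine ⟨continuous_torusLift huc hucube,
      (tsupport_torusLift_subset hucube).trans (Set.image_mono hus), ?_,
      mFourierCoeff_torusLift_nonneg hucube
        (fourier_comp_smul_nonneg hfF (inv_ne_zero hα.ne'))⟩
    have h := torusLift_toTorus u (x := 0) fun i => by constructor <;> norm_num
    have h0 : toTorus (0 : EuclideanSpace ℝ (Fin d)) = 0 := by ext i; simp [toTorus]
    rw [← h0, h, hu]
    simpa using hf0
  refine le_trans (le_of_eq ?_) (le_iSup₂ (f := fun f _ => ((f (toTorus (α • z)) : ℝ) : EReal))
    (torusLift u) hmem)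
  rw [torusLift_toTorus u (mem_Ioc_of_mem_centredCube hz), hu]
  simp only [inv_smul_smul₀ hα.ne']

theorem mul_le_spaceExtremal (hα : 0 < α) (hΩ : α • Ω ⊆ centredCube d)
    {φ : EuclideanSpace ℝ (Fin d) → ℝ} (hφ : Continuous φ) (hsupp : tsupport φ ⊆ centredCube d)
    (hφ0 : φ 0 = 1) (hφpos : ∀ ξ, 0 ≤ 𝓕 (fun x => (φ x : ℂ)) ξ)
    {f : UnitAddTorus (Fin d) → ℝ} (hf : f ∈ torusClass (toTorus '' (α • Ω))) :
    ((f (toTorus (α • z)) * φ (α • z) : ℝ) : EReal) ≤ spaceExtremal Ω z := by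
  obtain ⟨hfc, hfs, hf0, hfF⟩ := hf
  set g : EuclideanSpace ℝ (Fin d) → ℝ := fun x => f (toTorus (α • x)) * φ (α • x)
  have hcont : Continuous fun x : EuclideanSpace ℝ (Fin d) => α • x := by fun_prop
  have hgc : Continuous g :=
    (hfc.comp (continuous_toTorus.comp hcont)).mul (hφ.comp hcont)
  have hgs : tsupport g ⊆ {x | α • x ∈ tsupport φ ∧ toTorus (α • x) ∈ tsupport f} :=
    closure_minimal (fun x hx => ⟨subset_tsupport φ (right_ne_zero_of_mul hx),
      subset_tsupport f (left_ne_zero_of_mul hx)⟩)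
      (((isClosed_tsupport φ).preimage hcont).inter
        ((isClosed_tsupport f).preimage (continuous_toTorus.comp hcont)))
  have hcomp : HasCompactSupport g := by
    have hK := (isCompact_of_subset_centredCube (isClosed_tsupport φ) hsupp).smul α⁻¹
    refine hK.of_isClosed_subset (isClosed_tsupport g) fun x hx => ?_
    rw [Set.mem_smul_set_iff_inv_smul_mem₀ (inv_ne_zero hα.ne'), inv_inv]
    exact (hgs hx).1
  have hmem : g ∈ spaceClass Ω := by
    refine ⟨hgc, hgc.integrable_of_hasCompactSupport hcomp, fun x hx => ?_, ?_, ?_⟩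
    · obtain ⟨h1, h2⟩ := hgs hx
      obtain ⟨y, hy, hxy⟩ := hfs h2
      -- Multiplication by φ keeps only the copy of αΩ in the cube: both points lie there and have
      -- the same image, so they coincide.
      have := toTorus_injOn_centredCube (hΩ hy) (hsupp h1) hxy
      exact (Set.smul_mem_smul_set_iff₀ hα.ne' _ _).1 (this ▸ hy)
    · have h0 : toTorus (0 : EuclideanSpace ℝ (Fin d)) = 0 := by ext i; simp [toTorus]
      simp [g, h0, hf0, hφ0]
    · exact fourier_comp_smul_nonneg (u := fun x => f (toTorus x) * φ x)
        (fourier_toTorus_mul_nonneg hfc hfF hφ hsupp hφpos) hα.ne'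
  exact le_iSup₂ (f := fun f _ => ((f z : ℝ) : EReal)) g hmem

theorem eventually_smul_subset_centredCube (hb : Bornology.IsBounded Ω) :
    ∀ᶠ α : ℝ in 𝓝[>] 0, α • Ω ⊆ centredCube d := by
  obtain ⟨R, hR0, hR⟩ := hb.exists_pos_norm_le
  have hlim : Tendsto (fun α : ℝ => α * R) (𝓝[>] 0) (𝓝 0) := by
    have : Continuous fun α : ℝ => α * R := by fun_prop
    simpa using (this.tendsto 0).mono_left nhdsWithin_le_nhds
  filter_upwards [self_mem_nhdsWithin, hlim.eventually (gt_mem_nhds (one_half_pos (α := ℝ)))]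
    with α hα h
  rintro _ ⟨x, hx, rfl⟩ i
  have hα : 0 < α := hα
  have h1 := PiLp.norm_apply_le (α • x) i
  rw [norm_smul, Real.norm_of_nonneg hα.le, Real.norm_eq_abs] at h1
  have h2 := mul_le_mul_of_nonneg_left (hR x hx) hα.le
  exact (h1.trans h2).trans_lt h

end Limit

theorem mainTheorem3 (d : ℕ) (Ω : Set (EuclideanSpace ℝ (Fin d))) (hΩ : IsOpen Ω)
    (hb : Bornology.IsBounded Ω) (z : EuclideanSpace ℝ (Fin d)) :
    Tendsto (fun α : ℝ => torusExtremal (toTorus '' (α • Ω)) (toTorus (α • z)))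
      (𝓝[>] (0 : ℝ)) (𝓝 (spaceExtremal Ω z)) := by
  obtain ⟨φ, hφ, hsupp, hφ0, hφpos⟩ := exists_posDef_tsupport_subset_centredCube d
  have hlim : Tendsto (fun α : ℝ => φ (α • z)) (𝓝[>] 0) (𝓝 1) := by
    have : Continuous fun α : ℝ => φ (α • z) := by fun_prop
    simpa [hφ0] using (this.tendsto 0).mono_left nhdsWithin_le_nhds
  have hz := eventually_smul_subset_centredCube (Ω := {z}) Bornology.isBounded_singleton
  have hlower : ∀ᶠ α : ℝ in 𝓝[>] 0,
      spaceExtremal Ω z ≤ torusExtremal (toTorus '' (α • Ω)) (toTorus (α • z)) := by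
    filter_upwards [self_mem_nhdsWithin, eventually_smul_subset_centredCube hb, hz]
      with α hα h1 h2
    exact le_torusExtremal_smul hα h1 (h2 (Set.smul_mem_smul_set rfl))
  have hupper : ∀ᶠ α : ℝ in 𝓝[>] 0, ∀ f ∈ torusClass (toTorus '' (α • Ω)),
      ((f (toTorus (α • z)) * φ (α • z) : ℝ) : EReal) ≤ spaceExtremal Ω z := by
    filter_upwards [self_mem_nhdsWithin, eventually_smul_subset_centredCube hb] with α hα h1 f hf
    exact mul_le_spaceExtremal hα h1 hφ hsupp hφ0 hφpos hf
  have hpos := hlim.eventually (lt_mem_nhds zero_lt_one)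
  generalize spaceExtremal Ω z = M at hlower hupper ⊢
  induction M with
  | bot =>
    refine tendsto_const_nhds.congr' ?_
    filter_upwards [hupper] with α h
    -- A member of the torus class would bound a real number by `⊥`, so the class is empty.
    refine le_antisymm bot_le (iSup₂_le fun f hf => absurd (h f hf) ?_)
    exact not_le.2 (EReal.bot_lt_coe _)
  | top =>
    refine tendsto_const_nhds.congr' ?_
    filter_upwards [hlower] with α h
    exact (top_le_iff.1 h).symm
  | coe m =>
    -- Once φ(αz) > 0, the upper bound can be divided by it.
    have hr : Tendsto (fun α : ℝ => ((m / φ (α • z) : ℝ) : EReal)) (𝓝[>] 0) (𝓝 (m : EReal)) := by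
      refine (continuous_coe_real_ereal.tendsto m).comp ?_
      simpa [Pi.div_def] using (tendsto_const_nhds (x := m)).div hlim one_ne_zero
    refine tendsto_of_tendsto_of_tendsto_of_le_of_le' tendsto_const_nhds hr hlower ?_
    filter_upwards [hupper, hpos] with α h hp
    refine iSup₂_le fun f hf => EReal.coe_le_coe_iff.2 ?_
    exact (le_div_iff₀ hp).2 (EReal.coe_le_coe_iff.1 (h f hf))
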